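/- Let $n,k\ge 0$ be integers. For a row $r=(r_1,r_2)\in\mathbb F_2^2$ let $\rho(r)=\max\{j: r_j\ne 0\}$ if $r\neq 0$, and $\rho(0)=0$. For $v\in M_{n,2}(\mathbb F_2)$ with rows $v_1,\dots,v_n$ let $\mathrm{shape}(v)=(e_1,e_2)$, where $e_j=|\{i:\rho(v_i)=j\}|$. Put $\Delta_{n,2}=\{(e_1,e_2)\in\mathbb N^2: e_1+e_2\le n\}$ and, for $e\in\Delta_{n,2}$, $e_0=n-e_1-e_2$. On $M_{n,2}(\mathbb F_2)$ let $\langle u,v\rangle_N=\sum_{i=1}^n (u_{i,1}v_{i,2}+u_{i,2}v_{i,1})$. Let $\mathcal C\subseteq M_{n,2}(\mathbb F_2)$ be a binary $[n\times 2,k]$ NRT-LCD code, i.e. an $\mathbb F_2$-linear subspace of dimension $k$ with $\mathcal C\cap\mathcal C^{\perp_N}=\{0\}$, where $\mathcal C^{\perp_N}=\{u\in M_{n,2}(\mathbb F_2): \langle u,v\rangle_N=0\text{ for all }v\in\mathcal C\}$. Let $\mathcal A_e=|\{v\in\mathcal C:\mathrm{shape}(v)=e\}|$. Then for every $e\in\Delta_{n,2}$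 with $e\ne(0,0)$, $$2^k\mathcal A_e\le\sum_{e^\star\in\Delta_{n,2}}\mathcal A_{e^\star}\left[\binom{n}{e_0,e_1,e_2}2^{e_2}-B_e(e^\star)\right],$$ where $$B_e(e^\star)=2^{e_2}\left(\sum_{j=0}^{e_1}(-1)^j\binom{e^\star_2}{j}\binom{e^\star_0+e^\star_1-e_2}{e_1-j}\right)\left(\sum_{j=0}^{e_2}(-1)^j\binom{e^\star_1}{j}\binom{e^\star_0}{e_2-j}\right).$$ (If $e^\star_0+e^\star_1<e_2$, the last factor vanishes, so $B_e(e^\star)=0$ whatever the convention for binomial coefficients with negative upper entry.) -/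

import Mathlib

namespace NRT

/-- NRT weight of a row `r = (r_1, …, r_s)`: the largest (one-based) position of a nonzero entry,
and `0` for the zero row. The column index `j : Fin s` stands for the position `j + 1`. -/
def rowWeight {F : Type*} [Zero F] [DecidableEq F] {s : ℕ} (r : Fin s → F) : ℕ :=
  (Finset.univ.filter fun j : Fin s => r j ≠ 0).sup fun j => (j : ℕ) + 1

/-- NRT inner product `⟨u, v⟩_N = ∑ i, ∑ j, u_{i,j} v_{i,s-j+1}`; `Fin.rev` reverses the columns. -/
def inner {F : Type*} [CommRing F] {n s : ℕ} (u v : Matrix (Fin n) (Fin s) F) : F :=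
  ∑ i, ∑ j, u i j * v i (Fin.rev j)

/-- The NRT dual of a linear code. -/
def dual {F : Type*} [Field F] {n s : ℕ} (C : Submodule F (Matrix (Fin n) (Fin s) F)) :
    Submodule F (Matrix (Fin n) (Fin s) F) where
  carrier := {u | ∀ v ∈ C, inner u v = 0}
  zero_mem' := by
    intro v _
    simp [inner]
  add_mem' := by
    intro a b ha hb v hv
    have h1 := ha v hv
    have h2 := hb v hv
    simp only [inner] at h1 h2 ⊢
    simp only [Matrix.add_apply, add_mul, Finset.sum_add_distrib, h1, h2, add_zero]
  smul_mem' := by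
    intro c a ha v hv
    have h1 := ha v hv
    simp only [inner] at h1 ⊢
    simp only [Matrix.smul_apply, smul_eq_mul, mul_assoc, ← Finset.mul_sum, h1, mul_zero]

/-- A linear code is NRT-LCD if it meets its NRT dual only in `0`. -/
def IsLCD {F : Type*} [Field F] {n s : ℕ} (C : Submodule F (Matrix (Fin n) (Fin s) F)) : Prop :=
  C ⊓ dual C = ⊥

/-- The shape `(e₁, e₂)` of a matrix with two columns: `e_j` counts the rows of NRT weight `j`. -/
def shape {F : Type*} [Zero F] [DecidableEq F] {n : ℕ} (v : Matrix (Fin n) (Fin 2) F) : ℕ × ℕ :=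
  ((Finset.univ.filter fun i : Fin n => rowWeight (v i) = 1).card,
   (Finset.univ.filter fun i : Fin n => rowWeight (v i) = 2).card)

/-- The possible shapes: pairs `(e₁, e₂)` of natural numbers with `e₁ + e₂ ≤ n`. -/
def shapes (n : ℕ) : Finset (ℕ × ℕ) :=
  (Finset.range (n + 1) ×ˢ Finset.range (n + 1)).filter fun e => e.1 + e.2 ≤ n

/-- `e₀ = n - (e₁ + e₂)`, used only for `e ∈ shapes n`. -/
def zeroPart (n : ℕ) (e : ℕ × ℕ) : ℕ := n - (e.1 + e.2)

/-- The trinomial coefficient `n! / (e₀! e₁! e₂!)`. -/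
def trinomial (n : ℕ) (e : ℕ × ℕ) : ℕ :=
  Nat.multinomial Finset.univ ![zeroPart n e, e.1, e.2]

/-- The shape distribution: the number `A_e` of codewords of shape `e`. -/
noncomputable def shapeCount {n : ℕ} (C : Submodule (ZMod 2) (Matrix (Fin n) (Fin 2) (ZMod 2)))
    (e : ℕ × ℕ) : ℕ :=
  Nat.card {v : Matrix (Fin n) (Fin 2) (ZMod 2) // v ∈ C ∧ shape v = e}

/-- The MacWilliams coefficient `B_e(e*)`, with `f = e*`:
`2^{e₂} · ∏_{t=1,2} ∑_{j=0}^{e_t} (-1)^j C(e*_{3-t}, j) C(∑_{r=0}^{2-t} e*_r - ∑_{r=t+1}^{2} e_r, e_t - j)`.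
The only subtraction that can truncate is `e*_0 + e*_1 - e_2`; when it does, every term of the
factor `t = 2` is zero, and so is the coefficient. -/
def macWilliams (n : ℕ) (e f : ℕ × ℕ) : ℤ :=
  2 ^ e.2 *
    (∑ j ∈ Finset.range (e.1 + 1),
      (-1 : ℤ) ^ j * (f.2.choose j : ℤ) *
        ((zeroPart n f + f.1 - e.2).choose (e.1 - j) : ℤ)) *
    (∑ j ∈ Finset.range (e.2 + 1),
      (-1 : ℤ) ^ j * (f.1.choose j : ℤ) * ((zeroPart n f).choose (e.2 - j) : ℤ))

end NRT

namespace NRT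

open Polynomial

/-! An LCD code and its dual share only the zero matrix, so for nonzero `e` their words of shape `e`
are disjoint and together number at most all matrices of shape `e`. Scaled by `2 ^ k`, this is the
claim once the MacWilliams identity `sum_shapeCount_mul_macWilliams` rewrites `2 ^ k` times the dual
count. That identity comes from summing `signChar (inner u v)` over `v` in the code and `u` of shape
`e`. Summing over `v` first detects the dual; summing over `u` first gives a coefficient of a
product over rows (`sum_signChar_inner`). -/

/-- The nontrivial character of `ZMod 2`, with integer values. -/
def signChar : AddChar (ZMod 2) ℤ := AddChar.zmodChar 2 (ζ := (-1 : ℤ)) (by norm_num)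

lemma signChar_one : signChar 1 = -1 := by
  simp [signChar, AddChar.zmodChar_apply, ZMod.val_one]

lemma zmod_two_cases (a : ZMod 2) : a = 0 ∨ a = 1 := by
  revert a; decide

lemma signChar_eq_one_iff (a : ZMod 2) : signChar a = 1 ↔ a = 0 := by
  rcases zmod_two_cases a with rfl | rfl <;> simp [signChar_one]

lemma coeff_C_add_C_mul_X_pow {R : Type*} [CommRing R] (a b : R) (n m : ℕ) :
    ((C a + C b * X) ^ n).coeff m = a ^ (n - m) * b ^ m * (n.choose m : R) := by
  rw [add_comm, add_pow, finsetSum_coeff]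
  have h : ∀ i ∈ Finset.range (n + 1),
      ((C b * X : R[X]) ^ i * C a ^ (n - i) * (n.choose i : R[X])).coeff m =
        if m = i then a ^ (n - m) * b ^ m * (n.choose m : R) else 0 := by
    intro i _
    have : ((C b * X : R[X]) ^ i * C a ^ (n - i) * (n.choose i : R[X])) =
        C (a ^ (n - i) * b ^ i * (n.choose i : R)) * X ^ i := by
      simp only [map_mul, map_pow, map_natCast, mul_pow]; ring
    rw [this, coeff_C_mul, coeff_X_pow]
    split_ifs with h
    · subst h; simp
    · simp
  rw [Finset.sum_congr rfl h, Finset.sum_ite_eq]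
  split_ifs with hm
  · rfl
  · rw [Nat.choose_eq_zero_of_lt (by simpa using hm)]; simp

/-! ### Signed enumerators of single rows -/

/-- The monomial recording the NRT weight of a row with two entries. -/
noncomputable def rowMonomial (r : Fin 2 → ZMod 2) : ℤ[X][X] :=
  C (X ^ (if rowWeight r = 1 then 1 else 0)) * X ^ (if rowWeight r = 2 then 1 else 0)

lemma prod_rowMonomial {n : ℕ} (u : Matrix (Fin n) (Fin 2) (ZMod 2)) :
    ∏ i, rowMonomial (u i) = C (X ^ (shape u).1) * X ^ (shape u).2 := by
  simp only [rowMonomial, Finset.prod_mul_distrib, ← map_prod, Finset.prod_pow_eq_pow_sum,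
    shape, Finset.card_filter]

/-- The signed weight enumerator of the rows, as seen by a row of weight `w`. -/
noncomputable def rowFactor (w : ℕ) : ℤ[X][X] :=
  if w = 0 then C (1 + X) + C 2 * X else if w = 1 then C (1 + X) + C (-2) * X else C (1 - X)

lemma rowWeight_zero_zero : rowWeight (![0, 0] : Fin 2 → ZMod 2) = 0 := by decide
lemma rowWeight_one_zero : rowWeight (![1, 0] : Fin 2 → ZMod 2) = 1 := by decide
lemma rowWeight_zero_one : rowWeight (![0, 1] : Fin 2 → ZMod 2) = 2 := by decide
lemma rowWeight_one_one : rowWeight (![1, 1] : Fin 2 → ZMod 2) = 2 := by decide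

lemma sum_zmod_two_rows {M : Type*} [AddCommMonoid M] (g : (Fin 2 → ZMod 2) → M) :
    ∑ r, g r = g ![0, 0] + g ![1, 0] + g ![0, 1] + g ![1, 1] := by
  have h : (Finset.univ : Finset (Fin 2 → ZMod 2)) =
      {![0, 0], ![1, 0], ![0, 1], ![1, 1]} := by decide
  rw [h, Finset.sum_insert (by decide), Finset.sum_insert (by decide),
    Finset.sum_insert (by decide), Finset.sum_singleton]
  simp only [add_assoc]

lemma zmod_two_row_cases (r : Fin 2 → ZMod 2) :
    r = ![0, 0] ∨ r = ![1, 0] ∨ r = ![0, 1] ∨ r = ![1, 1] := by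
  revert r; decide

/-- The reversed pairing drives the cases: if `s` has weight 1, the sign is -1 exactly on rows of
weight 2; if `s` has weight 2, the row of weight 1 gets -1 and the two rows of weight 2 cancel. -/
lemma sum_row (s : Fin 2 → ZMod 2) :
    ∑ r : Fin 2 → ZMod 2,
      C (C (signChar (∑ j, r j * s (Fin.rev j)))) * rowMonomial r = rowFactor (rowWeight s) := by
  have h2 : (1 + 1 : ZMod 2) = 0 := by decide
  have hc : (C (2 : ℤ[X]) : ℤ[X][X]) = 2 := rfl
  have r0 : Fin.rev (0 : Fin 2) = 1 := by decide
  have r1 : Fin.rev (1 : Fin 2) = 0 := by decide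
  rw [sum_zmod_two_rows]
  rcases zmod_two_row_cases s with rfl | rfl | rfl | rfl <;>
  simp [rowMonomial, rowFactor, rowWeight_zero_zero, rowWeight_one_zero, rowWeight_zero_one,
    rowWeight_one_one, signChar_one, hc, h2, r0, r1] <;> ring

lemma rowWeight_le_two (r : Fin 2 → ZMod 2) : rowWeight r = 0 ∨ rowWeight r = 1 ∨
    rowWeight r = 2 := by
  rcases zmod_two_row_cases r with rfl | rfl | rfl | rfl <;>
  simp [rowWeight_zero_zero, rowWeight_one_zero, rowWeight_zero_one, rowWeight_one_one]

lemma card_rowWeight_eq_zero_add {n : ℕ} (v : Matrix (Fin n) (Fin 2) (ZMod 2)) :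
    (Finset.univ.filter fun i : Fin n => rowWeight (v i) = 0).card +
      ((shape v).1 + (shape v).2) = n := by
  simp only [shape, Finset.card_filter, ← Finset.sum_add_distrib]
  rw [Finset.sum_congr rfl (g := fun _ => 1)]
  · simp
  · intro i _
    rcases rowWeight_le_two (v i) with h | h | h <;> simp [h]

lemma shape_mem_shapes {n : ℕ} (v : Matrix (Fin n) (Fin 2) (ZMod 2)) : shape v ∈ shapes n := by
  have := card_rowWeight_eq_zero_add v
  simp only [shapes, Finset.mem_filter, Finset.mem_product, Finset.mem_range]
  omega

lemma prod_rowFactor {n : ℕ} (v : Matrix (Fin n) (Fin 2) (ZMod 2)) :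
    ∏ i, rowFactor (rowWeight (v i)) =
      (C (1 + X) + C 2 * X) ^ zeroPart n (shape v) * (C (1 + X) + C (-2) * X) ^ (shape v).1 *
        C ((1 - X) ^ (shape v).2) := by
  have h0 : zeroPart n (shape v) =
      (Finset.univ.filter fun i : Fin n => rowWeight (v i) = 0).card := by
    have := card_rowWeight_eq_zero_add v
    unfold zeroPart; omega
  have h (i : Fin n) : rowFactor (rowWeight (v i)) =
      (C (1 + X) + C 2 * X) ^ (if rowWeight (v i) = 0 then 1 else 0) *
      (C (1 + X) + C (-2) * X) ^ (if rowWeight (v i) = 1 then 1 else 0) *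
      C (1 - X) ^ (if rowWeight (v i) = 2 then 1 else 0) := by
    rcases rowWeight_le_two (v i) with h | h | h <;> simp [h, rowFactor]
  rw [h0]
  simp only [h, Finset.prod_mul_distrib, Finset.prod_pow_eq_pow_sum, shape,
    Finset.card_filter, map_pow]

/-- Taking `q` outer variables from the first two powers leaves `(1 + X) ^ (a + b - q)` in every
term, so the double coefficient factors. -/
lemma coeff_enumerator (a b c p q : ℕ) :
    (((C (1 + X) + C 2 * X : ℤ[X][X]) ^ a * (C (1 + X) + C (-2) * X) ^ b *
        C ((1 - X) ^ c)).coeff q).coeff p =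
      2 ^ q * (∑ j ∈ Finset.range (p + 1),
        (-1 : ℤ) ^ j * (c.choose j : ℤ) * ((a + b - q).choose (p - j) : ℤ)) *
      (∑ j ∈ Finset.range (q + 1),
        (-1 : ℤ) ^ j * (b.choose j : ℤ) * (a.choose (q - j) : ℤ)) := by
  have hq : ((C (1 + X) + C 2 * X : ℤ[X][X]) ^ a * (C (1 + X) + C (-2) * X) ^ b).coeff q =
      (1 + X) ^ (a + b - q) * C (2 ^ q * ∑ j ∈ Finset.range (q + 1),
        (-1 : ℤ) ^ j * (b.choose j : ℤ) * (a.choose (q - j) : ℤ)) := by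
    rw [mul_comm, coeff_mul, Finset.Nat.sum_antidiagonal_eq_sum_range_succ_mk, map_mul, map_sum,
      Finset.mul_sum, Finset.mul_sum]
    refine Finset.sum_congr rfl fun j hj => ?_
    have hj : j ≤ q := Nat.lt_succ_iff.mp (Finset.mem_range.mp hj)
    simp only [coeff_C_add_C_mul_X_pow]
    -- Outside these two vanishing cases `q ≤ a + b`, so no subtraction truncates.
    by_cases h1 : b < j
    · simp [Nat.choose_eq_zero_of_lt h1]
    by_cases h2 : a < q - j
    · simp [Nat.choose_eq_zero_of_lt h2]
    have e1 : a + b - q = (b - j) + (a - (q - j)) := by omega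
    have e2 : (2 : ℤ[X]) ^ q = 2 ^ j * 2 ^ (q - j) := by
      rw [← pow_add]; congr 1; omega
    have e3 : (-2 : ℤ[X]) ^ j = (-1) ^ j * 2 ^ j := by
      rw [← mul_pow]; norm_num
    rw [e1, pow_add]
    simp only [map_mul, map_pow, map_natCast, map_neg, map_one, map_ofNat, e2, e3]
    ring
  have hp : ((1 - X : ℤ[X]) ^ c * (1 + X) ^ (a + b - q)).coeff p =
      ∑ j ∈ Finset.range (p + 1),
        (-1 : ℤ) ^ j * (c.choose j : ℤ) * ((a + b - q).choose (p - j) : ℤ) := by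
    rw [coeff_mul, Finset.Nat.sum_antidiagonal_eq_sum_range_succ_mk]
    refine Finset.sum_congr rfl fun j _ => ?_
    have e : (1 - X : ℤ[X]) = C 1 + C (-1) * X := by simp [sub_eq_add_neg]
    simp only [e, coeff_C_add_C_mul_X_pow, coeff_one_add_X_pow]
    simp
  rw [coeff_mul_C, hq, mul_right_comm, mul_comm ((1 + X) ^ (a + b - q)), coeff_mul_C, hp]
  ring

/-- The character sum over all matrices of a given shape is a MacWilliams coefficient. -/
lemma sum_signChar_inner {n : ℕ} (e : ℕ × ℕ) (v : Matrix (Fin n) (Fin 2) (ZMod 2)) :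
    ∑ u : Matrix (Fin n) (Fin 2) (ZMod 2) with shape u = e, signChar (inner u v) =
      macWilliams n e (shape v) := by
  have h : ∑ u : Fin n → Fin 2 → ZMod 2,
      C (C (signChar (inner u v))) * (C (X ^ (shape u).1) * X ^ (shape u).2) =
        ∏ i, rowFactor (rowWeight (v i)) := by
    simp only [← sum_row, Finset.prod_univ_sum, Fintype.piFinset_univ]
    refine Finset.sum_congr rfl fun u _ => ?_
    have hm : ∏ i, rowMonomial (u i) = C (X ^ (shape u).1) * X ^ (shape u).2 := prod_rowMonomial u
    have hi : signChar (inner u v) = ∏ x, signChar (∑ j, u x j * v x (Fin.rev j)) :=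
      map_prod signChar.toMonoidHom (fun x => Multiplicative.ofAdd (∑ j, u x j * v x (Fin.rev j))) _
    rw [Finset.prod_mul_distrib, hm, hi, map_prod, map_prod]
  have h' := congrArg (fun P : ℤ[X][X] => (P.coeff e.2).coeff e.1) h
  simp only [prod_rowFactor, coeff_enumerator] at h'
  rw [macWilliams, ← h', finsetSum_coeff, finsetSum_coeff, Finset.sum_filter]
  refine Finset.sum_congr rfl fun u _ => ?_
  rw [coeff_C_mul, coeff_C_mul, coeff_C_mul, coeff_X_pow]
  by_cases h1 : e.1 = (shape u).1 <;> by_cases h2 : e.2 = (shape u).2 <;>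
    simp [Prod.ext_iff, h1, h2, coeff_X_pow, eq_comm]

/-- At `v = 0` every sign is 1, so the character sum counts matrices. -/
lemma card_shape_eq (n : ℕ) {e : ℕ × ℕ} (he : e ∈ shapes n) :
    ((Finset.univ.filter fun u : Matrix (Fin n) (Fin 2) (ZMod 2) => shape u = e).card : ℤ) =
      (trinomial n e : ℤ) * 2 ^ e.2 := by
  have he' : e.1 + e.2 ≤ n := (Finset.mem_filter.mp he).2
  have h := sum_signChar_inner e (0 : Matrix (Fin n) (Fin 2) (ZMod 2))
  have hs : shape (0 : Matrix (Fin n) (Fin 2) (ZMod 2)) = (0, 0) := by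
    have : rowWeight (0 : Fin 2 → ZMod 2) = 0 := by decide
    simp [shape, show ∀ i, (0 : Matrix (Fin n) (Fin 2) (ZMod 2)) i = 0 from fun _ => rfl, this]
  have hi (u : Matrix (Fin n) (Fin 2) (ZMod 2)) : signChar (inner u 0) = 1 := by
    simp [inner]
  have ht : trinomial n e = (n - e.2).choose e.1 * n.choose e.2 := by
    have h3 := Nat.multinomial_spec (Finset.univ : Finset (Fin 3)) ![zeroPart n e, e.1, e.2]
    have h1 := Nat.choose_mul_factorial_mul_factorial (show e.2 ≤ n by omega)
    have h2 := Nat.choose_mul_factorial_mul_factorial (show e.1 ≤ n - e.2 by omega)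
    have h0 : n - e.2 - e.1 = zeroPart n e := by unfold zeroPart; omega
    have hn : zeroPart n e + e.1 + e.2 = n := by unfold zeroPart; omega
    simp only [Fin.prod_univ_three, Fin.sum_univ_three, Matrix.cons_val_zero, Matrix.cons_val_one,
      Matrix.cons_val] at h3
    rw [hn, ← h1, ← h2, h0] at h3
    refine Nat.eq_of_mul_eq_mul_left
      (show 0 < (zeroPart n e).factorial * e.1.factorial * e.2.factorial by positivity) ?_
    rw [trinomial, h3]; ring
  have hsum (m q : ℕ) : ∑ j ∈ Finset.range (q + 1),
      (-1 : ℤ) ^ j * ((0 : ℕ).choose j : ℤ) * (m.choose (q - j) : ℤ) = m.choose q := by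
    rw [Finset.sum_range_succ']; simp
  simp only [hi, hs, macWilliams, hsum] at h
  simp only [Finset.sum_const, nsmul_eq_mul, mul_one] at h
  rw [h, ht]
  simp [zeroPart]
  ring

/-! ### Duality and the MacWilliams identity -/

/-- Pairing with `u` as an additive map. -/
def innerHom {n : ℕ} (u : Matrix (Fin n) (Fin 2) (ZMod 2)) :
    Matrix (Fin n) (Fin 2) (ZMod 2) →+ ZMod 2 where
  toFun v := inner u v
  map_zero' := by simp [inner]
  map_add' a b := by simp [inner, mul_add, Finset.sum_add_distrib]

open Classical in
-- Orthogonality: pairing with `u` gives a character of the code, trivial exactly when `u` is in the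
-- dual.
lemma sum_code_signChar {n : ℕ} (C : Submodule (ZMod 2) (Matrix (Fin n) (Fin 2) (ZMod 2)))
    (u : Matrix (Fin n) (Fin 2) (ZMod 2)) :
    ∑ v : C, signChar (inner u v) = if u ∈ dual C then (Fintype.card C : ℤ) else 0 := by
  have h := AddChar.sum_eq_ite (signChar.compAddMonoidHom ((innerHom u).comp C.subtype.toAddMonoidHom))
  have hz : signChar.compAddMonoidHom ((innerHom u).comp C.subtype.toAddMonoidHom) = 0 ↔
      u ∈ dual C := by
    rw [AddChar.eq_zero_iff]
    simp only [AddChar.compAddMonoidHom_apply, signChar_eq_one_iff]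
    exact ⟨fun h v hv => h ⟨v, hv⟩, fun h v => h v v.2⟩
  simp only [hz] at h
  exact h

open Classical in
lemma sum_shapeCount_mul {n : ℕ} (C : Submodule (ZMod 2) (Matrix (Fin n) (Fin 2) (ZMod 2)))
    (g : ℕ × ℕ → ℤ) :
    ∑ f ∈ shapes n, (shapeCount C f : ℤ) * g f = ∑ v : C, g (shape v.1) := by
  rw [← Finset.sum_fiberwise_of_maps_to (s := Finset.univ) (t := shapes n)
    (g := fun v : C => shape v.1) fun v _ => shape_mem_shapes v.1]
  refine Finset.sum_congr rfl fun f _ => ?_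
  rw [Finset.sum_congr rfl (g := fun _ => g f) fun v hv => by rw [(Finset.mem_filter.mp hv).2],
    Finset.sum_const, nsmul_eq_mul]
  congr 2
  rw [shapeCount, ← Fintype.card_subtype, ← Nat.card_eq_fintype_card]
  exact Nat.card_congr (Equiv.subtypeSubtypeEquivSubtypeInter (· ∈ C) (shape · = f)).symm

open Classical in
lemma shapeCount_eq_card_filter {n : ℕ}
    (C : Submodule (ZMod 2) (Matrix (Fin n) (Fin 2) (ZMod 2))) (e : ℕ × ℕ) :
    shapeCount C e = (Finset.univ.filter fun v => v ∈ C ∧ shape v = e).card := by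
  rw [shapeCount, Nat.card_eq_fintype_card, Fintype.card_subtype]

lemma IsLCD.shapeCount_add_shapeCount_dual_le {n : ℕ}
    {C : Submodule (ZMod 2) (Matrix (Fin n) (Fin 2) (ZMod 2))} (hC : IsLCD C) {e : ℕ × ℕ}
    (he0 : e ≠ (0, 0)) :
    shapeCount C e + shapeCount (dual C) e ≤
      (Finset.univ.filter fun u : Matrix (Fin n) (Fin 2) (ZMod 2) => shape u = e).card := by
  classical
  rw [shapeCount_eq_card_filter, shapeCount_eq_card_filter, ← Finset.card_union_of_disjoint]
  · refine Finset.card_le_card fun v hv => ?_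
    simp only [Finset.mem_union, Finset.mem_filter] at hv ⊢
    tauto
  · rw [Finset.disjoint_left]
    intro v hv hv'
    simp only [Finset.mem_filter] at hv hv'
    have h : v ∈ C ⊓ dual C := ⟨hv.2.1, hv'.2.1⟩
    rw [hC, Submodule.mem_bot] at h
    subst h
    apply he0
    rw [← hv.2.2]
    have : rowWeight (0 : Fin 2 → ZMod 2) = 0 := by decide
    simp [shape, show ∀ i, (0 : Matrix (Fin n) (Fin 2) (ZMod 2)) i = 0 from fun _ => rfl, this]

/-- The MacWilliams identity for shape distributions. -/
lemma sum_shapeCount_mul_macWilliams {n : ℕ}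
    (C : Submodule (ZMod 2) (Matrix (Fin n) (Fin 2) (ZMod 2))) (e : ℕ × ℕ) :
    ∑ f ∈ shapes n, (shapeCount C f : ℤ) * macWilliams n e f =
      (Nat.card C : ℤ) * shapeCount (dual C) e := by
  classical
  rw [sum_shapeCount_mul]
  simp only [← sum_signChar_inner]
  rw [Finset.sum_comm]
  simp only [sum_code_signChar]
  rw [← Finset.sum_filter, Finset.sum_const, nsmul_eq_mul, Finset.filter_filter,
    shapeCount_eq_card_filter, Nat.card_eq_fintype_card, mul_comm]
  simp only [and_comm]

end NRT

theorem mainTheorem6 (n k : ℕ) (C : Submodule (ZMod 2) (Matrix (Fin n) (Fin 2) (ZMod 2)))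
    (hk : Module.finrank (ZMod 2) C = k) (hC : NRT.IsLCD C)
    (e : ℕ × ℕ) (he : e ∈ NRT.shapes n) (he0 : e ≠ (0, 0)) :
    (2 : ℤ) ^ k * (NRT.shapeCount C e : ℤ) ≤
      ∑ f ∈ NRT.shapes n, (NRT.shapeCount C f : ℤ) *
        ((NRT.trinomial n e : ℤ) * 2 ^ e.2 - NRT.macWilliams n e f) := by
  have hcard : Nat.card C = 2 ^ k := by
    rw [Module.natCard_eq_pow_finrank (K := ZMod 2), hk, Nat.card_zmod]
  have hsum : ∑ f ∈ NRT.shapes n, (NRT.shapeCount C f : ℤ) *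
      ((NRT.trinomial n e : ℤ) * 2 ^ e.2) = 2 ^ k * ((NRT.trinomial n e : ℤ) * 2 ^ e.2) := by
    classical
    rw [NRT.sum_shapeCount_mul C fun _ => (NRT.trinomial n e : ℤ) * 2 ^ e.2, Finset.sum_const,
      nsmul_eq_mul, Finset.card_univ, ← Nat.card_eq_fintype_card, hcard]
    push_cast
    rfl
  simp only [mul_sub, Finset.sum_sub_distrib]
  rw [hsum, NRT.sum_shapeCount_mul_macWilliams, hcard, ← NRT.card_shape_eq n he]
  push_cast
  rw [← mul_sub]
  -- With `2 ^ k` factored out, only the disjointness count remains.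
  refine mul_le_mul_of_nonneg_left ?_ (by positivity)
  have h := hC.shapeCount_add_shapeCount_dual_le he0
  omega
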